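/- **Theorem (Homogeneous Strong Duality).** Let $Q\in\mathbb R^{n\times n}$, $c\in\mathbb R^n$, $A\in\mathbb R^{m\times n}$, $b\in\mathbb R^m$ and $B\subseteq\{1,\dots,n\}$, and consider the mixed-binary quadratic program $$\text{(MBQP)}\qquad \min_{x\in\mathbb R^n}\ x^\top Qx+2c^\top x\quad\text{s.t.}\quad Ax=b,\ x\ge 0,\ x_j\in\{0,1\}\ (j\in B).$$ Let $\mathcal C^*_{n+1}$ be the cone of completely positive matrices, i.e. the finite sums $\sum_k z^{(k)}(z^{(k)})^\top$ with $z^{(k)}\in\mathbb R^{n+1}_{\ge 0}$; let $\mathcal C_{n+1}=\{M\in\mathbb R^{(n+1)\times(n+1)} : v^\top Mv\ge 0\ \text{for all } v\in\mathbb R^{n+1}_{\ge0}\}$ be the cone of copositive matrices; and let $\langle M,N\rangle=\operatorname{Tr}(M^\top N)$. Write $a_i^\top$ for the $i$-th row of $A$, $e_j$ for the $j$-th standard basis vector of $\mathbb R^n$, and $$\tilde Q=\begin{pmatrix}Q&c\\c^\top&0\end{pmatrix},\quad L_i=\begin{pmatrix}a_ia_i^\top&-b_ia_i\\-b_ia_i^\top&b_i^2\end{pmatrix},\quad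 N_j=\begin{pmatrix}-e_je_j^\top&\tfrac12e_j\\\tfrac12e_j^\top&0\end{pmatrix},\quad E=\begin{pmatrix}0&0\\0&1\end{pmatrix}.$$ The homogenized completely positive program is $$\text{(Hom-CPP)}\qquad \min_{x\in\mathbb R^n,\,X\in\mathbb R^{n\times n}}\ \langle\tilde Q,Y\rangle\quad\text{s.t.}\quad \langle L_i,Y\rangle=0\ (1\le i\le m),\ \ \langle N_j,Y\rangle=0\ (j\in B),\ \ Y:=\begin{pmatrix}X&x\\x^\top&1\end{pmatrix}\in\mathcal C^*_{n+1},$$ and its Lagrangian dual copositive program is $$\text{(Hom-COP)}\qquad \sup_{\mu\in\mathbb R^m,\,\lambda\in\mathbb R^B,\,\gamma\in\mathbb R}\ \gamma\quad\text{s.t.}\quad \tilde Q-\sum_{i=1}^m\mu_iL_i-\sum_{j\in B}\lambda_jN_j-\gamma E\in\mathcal C_{n+1}.$$ If the feasible region of (MBQP) is nonempty and bounded, then strong duality holds between (Hom-CPP) and (Hom-COP): the minimum in (Hom-CPP) is attained, (Hom-COP) is feasible, and the two optimal values are finite and equal, $$\min\text{(Hom-CPP)}=\sup\text{(Hom-COP)}.$$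 -/

import Mathlib

noncomputable section

/-- The matrix inner product `⟨M, N⟩ = Tr(Mᵀ N)`. -/
def matInner {ι : Type*} [Fintype ι] (M N : Matrix ι ι ℝ) : ℝ :=
  (M.transpose * N).trace

/-- The cone of completely positive matrices: finite sums of `z zᵀ` with `z` entrywise nonnegative. -/
def completelyPositiveCone (ι : Type*) : Set (Matrix ι ι ℝ) :=
  {X | ∃ (K : ℕ) (z : Fin K → ι → ℝ),
    (∀ k i, 0 ≤ z k i) ∧ X = ∑ k, Matrix.vecMulVec (z k) (z k)}

/-- The cone of copositive matrices: `vᵀ M v ≥ 0` for all entrywise nonnegative `v`. -/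
def copositiveCone (ι : Type*) [Fintype ι] : Set (Matrix ι ι ℝ) :=
  {M | ∀ v : ι → ℝ, (∀ i, 0 ≤ v i) → 0 ≤ dotProduct v (M.mulVec v)}

/-- The block matrix with rows `(P, p)` and `(pᵀ, t)`, of size `n + 1`; the index type
`Fin n ⊕ Unit` has `n + 1` elements, the last of which is `Sum.inr ()`. -/
def blockMat {n : ℕ} (P : Matrix (Fin n) (Fin n) ℝ) (p : Fin n → ℝ) (t : ℝ) :
    Matrix (Fin n ⊕ Unit) (Fin n ⊕ Unit) ℝ :=
  Matrix.fromBlocks P (Matrix.replicateCol Unit p) (Matrix.replicateRow Unit p)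
    (Matrix.of fun _ _ => t)

/-- The data of a mixed-binary quadratic program: minimize `xᵀ Q x + 2 cᵀ x` over `x ∈ ℝⁿ` subject
to `A x = b`, `x ≥ 0` and `x j ∈ {0, 1}` for `j ∈ B`. -/
structure MBQP (m n : ℕ) where
  Q : Matrix (Fin n) (Fin n) ℝ
  c : Fin n → ℝ
  A : Matrix (Fin m) (Fin n) ℝ
  b : Fin m → ℝ
  B : Finset (Fin n)

namespace MBQP

variable {m n : ℕ} (P : MBQP m n)

/-- The feasible region of the mixed-binary quadratic program. -/
def feasibleRegion : Set (Fin n → ℝ) :=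
  {x | P.A.mulVec x = P.b ∧ (∀ j, 0 ≤ x j) ∧ ∀ j ∈ P.B, x j = 0 ∨ x j = 1}

/-- The objective matrix, with rows `(Q, c)` and `(cᵀ, 0)`. -/
def objMat : Matrix (Fin n ⊕ Unit) (Fin n ⊕ Unit) ℝ :=
  blockMat P.Q P.c 0

/-- The matrix of the `i`-th homogenized linear constraint, with rows `(aᵢ aᵢᵀ, -bᵢ aᵢ)` and
`(-bᵢ aᵢᵀ, bᵢ²)`, where `aᵢᵀ` is the `i`-th row of `A`. -/
def linMat (i : Fin m) : Matrix (Fin n ⊕ Unit) (Fin n ⊕ Unit) ℝ :=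
  blockMat (Matrix.vecMulVec (P.A i) (P.A i)) (-(P.b i) • P.A i) (P.b i ^ 2)

/-- The matrix of the constraint for the binary variable `j`, with rows `(-eⱼ eⱼᵀ, eⱼ / 2)` and
`(eⱼᵀ / 2, 0)`. -/
def binMat (j : Fin n) : Matrix (Fin n ⊕ Unit) (Fin n ⊕ Unit) ℝ :=
  blockMat (-Matrix.vecMulVec (Pi.single j 1) (Pi.single j 1)) ((1 / 2 : ℝ) • Pi.single j 1) 0

/-- The feasible pairs `(x, X)` of the homogenized completely positive program. -/
def homCPPFeasible : Set ((Fin n → ℝ) × Matrix (Fin n) (Fin n) ℝ) :=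
  {p | (∀ i, matInner (P.linMat i) (blockMat p.2 p.1 1) = 0) ∧
    (∀ j ∈ P.B, matInner (binMat j) (blockMat p.2 p.1 1) = 0) ∧
    blockMat p.2 p.1 1 ∈ completelyPositiveCone (Fin n ⊕ Unit)}

/-- The objective of the homogenized completely positive program, to be minimized. -/
def homCPPObjective (p : (Fin n → ℝ) × Matrix (Fin n) (Fin n) ℝ) : ℝ :=
  matInner P.objMat (blockMat p.2 p.1 1)

/-- The matrix that the Lagrangian dual requires to be copositive. -/
def dualMat (μ : Fin m → ℝ) (lam : P.B → ℝ) (γ : ℝ) :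
    Matrix (Fin n ⊕ Unit) (Fin n ⊕ Unit) ℝ :=
  P.objMat - ∑ i, μ i • P.linMat i - ∑ j : P.B, lam j • binMat (j : Fin n) -
    γ • blockMat 0 0 1

/-- The feasible triples `(μ, λ, γ)` of the homogenized copositive program. -/
def homCOPFeasible : Set ((Fin m → ℝ) × (P.B → ℝ) × ℝ) :=
  {d | P.dualMat d.1 d.2.1 d.2.2 ∈ copositiveCone (Fin n ⊕ Unit)}

/-- The objective `γ` of the homogenized copositive program, to be maximized. -/
def homCOPObjective (d : (Fin m → ℝ) × (P.B → ℝ) × ℝ) : ℝ := d.2.2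

end MBQP

end

open Matrix Set

/-! ### Convex hulls and separation in finite dimension. -/

section ConvexAnalysis

/-! On a rank-one matrix `z zᵀ` with `z = (x, t)` the constraint forms are `(aᵢᵀx - bᵢt)²` and `t xⱼ
- xⱼ²`. Let `K` be the cone of completely positive matrices on which all of them vanish. If `Y ∈ K`
has corner entry 0, every summand has `t = 0`, so its `x` is a recession direction of the feasible
region with zero binary coordinates; boundedness forces `x = 0`. Hence the corner is positive on `K
\ {0}` (`matInner_corner_pos`).

Hom-CPP therefore minimizes the scale-invariant ratio `⟨Q̃,Y⟩ / ⟨E,Y⟩` over the trace-one slice of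
`K`, which is compact, so the minimum `v` is attained (`exists_isLeast_homCPP`). For `γ < v` the
functional `⟨Q̃ - γE, ·⟩` is positive on that slice. Separation (`exists_multipliers_of_pos`) yields
multipliers making it positive on the whole compact base of the completely positive cone, that is, a
dual feasible point of value `γ`. No Slater condition is needed. With weak duality, the two values
agree. -/

/-- The convex hull of a compact subset of a finite-dimensional space is compact. -/
theorem IsCompact.convexHull_of_finiteDimensional {V : Type*} [AddCommGroup V] [Module ℝ V]
    [TopologicalSpace V] [ContinuousAdd V] [ContinuousSMul ℝ V]
    [FiniteDimensional ℝ V] {s : Set V} (hs : IsCompact s) : IsCompact (convexHull ℝ s) := by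
  obtain rfl | ⟨s₀, hs₀⟩ := s.eq_empty_or_nonempty
  · simp
  -- Carathéodory: `N` points always suffice. Shorter combinations are padded with weight 0 at `s₀`,
  -- so the hull is the image of one compact set.
  set N := Module.finrank ℝ V + 1
  have hcomp : IsCompact (stdSimplex ℝ (Fin N) ×ˢ Set.pi univ fun _ : Fin N => s) :=
    (isCompact_stdSimplex ℝ (Fin N)).prod (isCompact_univ_pi fun _ => hs)
  have hcont : Continuous fun p : (Fin N → ℝ) × (Fin N → V) => ∑ i, p.1 i • p.2 i := by
    fun_prop
  convert hcomp.image hcont using 1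
  apply Subset.antisymm
  · intro x hx
    obtain ⟨ι, _, z, w, hz, hind, hw, hw1, rfl⟩ := eq_pos_convex_span_of_mem_convexHull hx
    have hcard : Fintype.card ι ≤ N :=
      hind.card_le_finrank_succ.trans
        (Nat.succ_le_succ (Submodule.finrank_le (vectorSpan ℝ (range z))))
    obtain ⟨e⟩ : Nonempty (ι ↪ Fin N) :=
      Function.Embedding.nonempty_of_card_le (by simpa using hcard)
    have hwe : ∀ i, Function.extend e w 0 (e i) = w i := fun i => e.injective.extend_apply _ _ _
    have hwn : ∀ k, k ∉ range e → Function.extend e w 0 k = 0 := fun k hk =>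
      Function.extend_apply' _ _ _ hk
    have hze : ∀ i, Function.extend e z (fun _ => s₀) (e i) = z i := fun i =>
      e.injective.extend_apply _ _ _
    refine ⟨(Function.extend e w 0, Function.extend e z fun _ => s₀), ⟨⟨fun k => ?_, ?_⟩, ?_⟩, ?_⟩
    · by_cases hk : k ∈ range e
      · obtain ⟨i, rfl⟩ := hk
        exact (hw i).le.trans_eq (hwe i).symm
      · exact (hwn k hk).ge
    · rw [← hw1]
      exact (Fintype.sum_of_injective e e.injective _ _ hwn fun i => (hwe i).symm).symm
    · intro k _
      by_cases hk : k ∈ range e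
      · obtain ⟨i, rfl⟩ := hk
        simpa only [hze] using hz (mem_range_self i)
      · simpa only [Function.extend_apply' _ _ _ hk] using hs₀
    · refine (Fintype.sum_of_injective e e.injective _ _ (fun k hk => ?_) fun i => ?_).symm
      · simp only [hwn k hk, zero_smul]
      · simp only [hwe, hze]
  · rintro _ ⟨⟨w, z⟩, ⟨⟨hw, hw1⟩, hz⟩, rfl⟩
    exact (convex_convexHull ℝ s).sum_mem (fun i _ => hw i) hw1
      fun i _ => subset_convexHull ℝ s (hz i (mem_univ i))

/-- A linear functional that is positive on the nonempty zero set of finitely many linear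
functionals in a compact convex set becomes positive on the whole set after adding a linear
combination of those functionals. -/
theorem exists_multipliers_of_pos {V κ : Type*} [AddCommGroup V] [Module ℝ V]
    [TopologicalSpace V] [Fintype κ] {S : Set V} (hconv : Convex ℝ S)
    (hS : IsCompact S) (L : κ → V →L[ℝ] ℝ) (q : V →L[ℝ] ℝ)
    (hne : ∃ y ∈ S, ∀ k, L k y = 0) (hpos : ∀ y ∈ S, (∀ k, L k y = 0) → 0 < q y) :
    ∃ c : κ → ℝ, ∀ y ∈ S, 0 < q y + ∑ k, c k * L k y := by
  let T : V →L[ℝ] (κ → ℝ) × ℝ := (ContinuousLinearMap.pi L).prod q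
  -- Positivity of `q` on the common zeros says exactly that `T '' S` misses `R`.
  let R : Set ((κ → ℝ) × ℝ) := {0} ×ˢ Iic 0
  have hdisj : Disjoint (T '' S) R := by
    rw [Set.disjoint_left]
    rintro _ ⟨y, hy, rfl⟩ ⟨h1, h2⟩
    exact (hpos y hy fun k => congrFun h1 k).not_ge h2
  obtain ⟨f, u, v, hfS, huv, hfR⟩ := geometric_hahn_banach_compact_closed
    (hconv.linear_image (T : V →ₗ[ℝ] _)) (hS.image T.continuous)
    ((convex_singleton (0 : κ → ℝ)).prod (convex_Iic (0 : ℝ)))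
    (isClosed_singleton.prod isClosed_Iic) hdisj
  classical
  have hf : ∀ (a : κ → ℝ) (t : ℝ),
      f (a, t) = ∑ k, a k * f (Pi.single k 1, 0) + t * f (0, 1) := by
    intro a t
    have h : (a, t) = ∑ k, a k • ((Pi.single k 1, 0) : (κ → ℝ) × ℝ) + t • (0, 1) := by
      ext k
      · simp [Prod.fst_sum, Finset.sum_apply, Pi.single_apply]
      · simp [Prod.snd_sum]
    conv_lhs => rw [h]
    simp only [map_add, map_sum, map_smul, smul_eq_mul]
  set s := f (0, 1)
  have hv : v < 0 := by
    have := hfR (0, 0) ⟨rfl, le_refl (0 : ℝ)⟩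
    rwa [show ((0, 0) : (κ → ℝ) × ℝ) = 0 from rfl, map_zero] at this
  have hTf : ∀ y ∈ S, ∑ k, L k y * f (Pi.single k 1, 0) + q y * s < 0 := fun y hy => by
    have h := hfS _ ⟨y, hy, rfl⟩
    change f ((fun k => L k y), q y) < u at h
    rw [hf] at h
    exact h.trans (huv.trans hv)
  -- At a common zero only `q y * s` survives, so the sign of `s` is forced and dividing by it is
  -- legitimate.
  have hs : s < 0 := by
    obtain ⟨y, hy, hLy⟩ := hne
    have h := hTf y hy
    simp only [hLy, zero_mul, Finset.sum_const_zero, zero_add] at h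
    by_contra! hs
    exact h.not_ge (mul_nonneg (hpos y hy hLy).le hs)
  refine ⟨fun k => f (Pi.single k 1, 0) / s, fun y hy => ?_⟩
  have h := div_pos_of_neg_of_neg (hTf y hy) hs
  rw [add_div, mul_div_cancel_right₀ _ hs.ne, Finset.sum_div] at h
  calc 0 < _ := h
    _ = _ := by
      rw [add_comm]
      congr 1
      exact Finset.sum_congr rfl fun k _ => by ring

end ConvexAnalysis

/-! ### The completely positive cone, its compact base and copositivity. -/

section CompletelyPositive

theorem smul_mem_completelyPositiveCone {ι : Type*} {Y : Matrix ι ι ℝ} (hY : Y ∈ completelyPositiveCone ι)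
    {a : ℝ} (ha : 0 ≤ a) : a • Y ∈ completelyPositiveCone ι := by
  obtain ⟨K, z, hz, rfl⟩ := hY
  refine ⟨K, fun k => √a • z k, fun k i => mul_nonneg (Real.sqrt_nonneg a) (hz k i), ?_⟩
  simp only [smul_vecMulVec, vecMulVec_smul, smul_smul, Real.mul_self_sqrt ha, Finset.smul_sum]

theorem add_mem_completelyPositiveCone {ι : Type*} {Y Z : Matrix ι ι ℝ} (hY : Y ∈ completelyPositiveCone ι)
    (hZ : Z ∈ completelyPositiveCone ι) : Y + Z ∈ completelyPositiveCone ι := by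
  obtain ⟨K, y, hy, rfl⟩ := hY
  obtain ⟨M, z, hz, rfl⟩ := hZ
  refine ⟨K + M, Fin.append y z, fun k => ?_, ?_⟩
  · refine Fin.addCases (fun k => ?_) (fun k => ?_) k
    · simpa using hy k
    · simpa using hz k
  · simp [Fin.sum_univ_add]

theorem vecMulVec_mem_completelyPositiveCone {ι : Type*} {z : ι → ℝ} (hz : ∀ i, 0 ≤ z i) :
    vecMulVec z z ∈ completelyPositiveCone ι :=
  ⟨1, fun _ => z, fun _ => hz, by simp⟩

variable {ι : Type*} [Fintype ι]

/-- The matrix inner product with a fixed matrix, as a continuous linear functional. -/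
def matInnerCLM (M : Matrix ι ι ℝ) : Matrix ι ι ℝ →L[ℝ] ℝ where
  toFun := matInner M
  map_add' := by simp [matInner, Matrix.mul_add]
  map_smul' := by simp [matInner]
  cont := by unfold matInner; fun_prop

@[simp]
theorem matInnerCLM_apply (M Y : Matrix ι ι ℝ) : matInnerCLM M Y = matInner M Y := rfl

theorem matInner_vecMulVec (M : Matrix ι ι ℝ) (z : ι → ℝ) :
    matInner M (vecMulVec z z) = z ⬝ᵥ M *ᵥ z := by
  rw [matInner, mul_vecMulVec, trace_vecMulVec, mulVec_transpose, dotProduct_mulVec]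

/-- The inner product with a sum of rank-one matrices is a sum of quadratic form values. -/
theorem matInner_sum_vecMulVec {κ : Type*} (M : Matrix ι ι ℝ) (s : Finset κ) (z : κ → ι → ℝ) :
    matInner M (∑ k ∈ s, vecMulVec (z k) (z k)) = ∑ k ∈ s, z k ⬝ᵥ M *ᵥ z k := by
  rw [← matInnerCLM_apply, map_sum]
  simp only [matInnerCLM_apply, matInner_vecMulVec]

/-- The normalized rank-one completely positive matrices. -/
def normalizedRankOne (ι : Type*) [Fintype ι] : Set (Matrix ι ι ℝ) :=
  (fun z : ι → ℝ => vecMulVec z z) '' {z | (∀ i, 0 ≤ z i) ∧ z ⬝ᵥ z = 1}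

theorem isCompact_normalizedRankOne : IsCompact (normalizedRankOne ι) := by
  refine IsCompact.image ?_ (by fun_prop)
  refine (isCompact_Icc (a := (0 : ι → ℝ)) (b := 1)).of_isClosed_subset ?_ ?_
  · refine IsClosed.inter (s₁ := {z : ι → ℝ | ∀ i, 0 ≤ z i}) ?_ ?_
    · simp only [ofPred_forall]
      exact isClosed_iInter fun i => isClosed_le continuous_const (continuous_apply i)
    · exact isClosed_eq (by fun_prop) continuous_const
  · rintro z ⟨hz, h1⟩
    refine ⟨hz, fun i => ?_⟩
    have h : z i * z i ≤ z ⬝ᵥ z :=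
      Finset.single_le_sum (f := fun i => z i * z i) (fun j _ => mul_self_nonneg (z j))
        (Finset.mem_univ i)
    rw [h1] at h
    simp only [Pi.one_apply]
    nlinarith [hz i]

/-- A compact base of the cone of completely positive matrices. -/
def completelyPositiveBase (ι : Type*) [Fintype ι] : Set (Matrix ι ι ℝ) :=
  convexHull ℝ (normalizedRankOne ι)

theorem isCompact_completelyPositiveBase : IsCompact (completelyPositiveBase ι) :=
  isCompact_normalizedRankOne.convexHull_of_finiteDimensional

theorem completelyPositiveBase_subset :
    completelyPositiveBase ι ⊆ {Y ∈ completelyPositiveCone ι | Y.trace = 1} := by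
  refine convexHull_min ?_ ?_
  · rintro _ ⟨z, ⟨hz, h1⟩, rfl⟩
    exact ⟨vecMulVec_mem_completelyPositiveCone hz, by simpa [trace_vecMulVec] using h1⟩
  · rintro Y ⟨hY, hY1⟩ Z ⟨hZ, hZ1⟩ a b ha hb hab
    exact ⟨add_mem_completelyPositiveCone (smul_mem_completelyPositiveCone hY ha)
      (smul_mem_completelyPositiveCone hZ hb), by simp [hY1, hZ1, hab]⟩

theorem exists_normalizedRankOne [Nonempty ι] {z : ι → ℝ} (hz : ∀ i, 0 ≤ z i) :
    ∃ W ∈ normalizedRankOne ι, vecMulVec z z = (z ⬝ᵥ z) • W := by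
  classical
  obtain rfl | h0 := eq_or_ne z 0
  -- For `z = 0` the coefficient is 0, so any unit vector serves.
  · obtain ⟨i⟩ := ‹Nonempty ι›
    refine ⟨_, ⟨Pi.single i 1, ⟨fun j => ?_, by simp⟩, rfl⟩, by simp⟩
    by_cases h : j = i
    · subst h; simp
    · simp [h]
  · have hpos : 0 < z ⬝ᵥ z := by
      refine lt_of_le_of_ne (Finset.sum_nonneg fun i _ => mul_self_nonneg (z i)) ?_
      exact fun h => h0 (dotProduct_self_eq_zero.1 h.symm)
    set r := z ⬝ᵥ z with hr
    have hsq : (√r)⁻¹ * (√r)⁻¹ = r⁻¹ := by rw [← mul_inv, Real.mul_self_sqrt hpos.le]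
    refine ⟨_, ⟨(√r)⁻¹ • z, ⟨fun i => ?_, ?_⟩, rfl⟩, ?_⟩
    · exact mul_nonneg (inv_nonneg.2 (Real.sqrt_nonneg r)) (hz i)
    · rw [smul_dotProduct, dotProduct_smul, smul_smul, hsq, ← hr, smul_eq_mul,
        inv_mul_cancel₀ hpos.ne']
    · simp only [smul_vecMulVec, vecMulVec_smul, smul_smul]
      rw [hsq, mul_inv_cancel₀ hpos.ne', one_smul]

theorem mem_completelyPositiveBase_iff [Nonempty ι] {Y : Matrix ι ι ℝ} :
    Y ∈ completelyPositiveBase ι ↔ Y ∈ completelyPositiveCone ι ∧ Y.trace = 1 := by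
  refine ⟨fun h => completelyPositiveBase_subset h, ?_⟩
  rintro ⟨⟨K, z, hz, rfl⟩, h1⟩
  choose W hW hzW using fun k => exists_normalizedRankOne (hz k)
  simp only [trace_sum, trace_vecMulVec] at h1
  simp only [hzW]
  -- The weights `z k ⬝ᵥ z k` sum to the trace, which is 1.
  exact (convex_convexHull ℝ _).sum_mem
    (fun k _ => Finset.sum_nonneg fun i _ => mul_self_nonneg (z k i)) h1
    fun k _ => subset_convexHull ℝ _ (hW k)

theorem trace_pos_of_mem_completelyPositiveCone {Y : Matrix ι ι ℝ}
    (hY : Y ∈ completelyPositiveCone ι) (h0 : Y ≠ 0) : 0 < Y.trace := by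
  obtain ⟨K, z, hz, rfl⟩ := hY
  have hnn : ∀ k, 0 ≤ z k ⬝ᵥ z k := fun k => Finset.sum_nonneg fun i _ => mul_self_nonneg (z k i)
  simp only [trace_sum, trace_vecMulVec]
  refine lt_of_le_of_ne (Finset.sum_nonneg fun k _ => hnn k) fun h => h0 ?_
  have h' := (Finset.sum_eq_zero_iff_of_nonneg fun k _ => hnn k).1 h.symm
  refine Finset.sum_eq_zero fun k hk => ?_
  rw [dotProduct_self_eq_zero.1 (h' k hk), vecMulVec_zero]

/-- Copositive and completely positive matrices have nonnegative inner product. -/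
theorem matInner_nonneg {M Y : Matrix ι ι ℝ} (hM : M ∈ copositiveCone ι)
    (hY : Y ∈ completelyPositiveCone ι) : 0 ≤ matInner M Y := by
  obtain ⟨K, z, hz, rfl⟩ := hY
  rw [matInner_sum_vecMulVec]
  exact Finset.sum_nonneg fun k _ => hM _ (hz k)

/-- A matrix with nonnegative inner product with the base of the completely positive cone is
copositive. -/
theorem mem_copositiveCone_of_matInner_nonneg [Nonempty ι] {M : Matrix ι ι ℝ}
    (hM : ∀ Y ∈ completelyPositiveBase ι, 0 ≤ matInner M Y) : M ∈ copositiveCone ι := by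
  intro z hz
  obtain ⟨W, hW, h⟩ := exists_normalizedRankOne hz
  rw [← matInner_vecMulVec, h, ← matInnerCLM_apply, map_smul, matInnerCLM_apply]
  exact mul_nonneg (Finset.sum_nonneg fun i _ => mul_self_nonneg (z i))
    (hM W (subset_convexHull ℝ _ hW))

end CompletelyPositive

/-! ### Quadratic forms of block matrices. -/

theorem dotProduct_blockMat_mulVec {n : ℕ} (P : Matrix (Fin n) (Fin n) ℝ) (p : Fin n → ℝ) (s : ℝ)
    (z : Fin n ⊕ Unit → ℝ) :
    z ⬝ᵥ blockMat P p s *ᵥ z =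
      (z ∘ Sum.inl) ⬝ᵥ P *ᵥ (z ∘ Sum.inl) + 2 * z (Sum.inr ()) * (p ⬝ᵥ (z ∘ Sum.inl)) +
        s * z (Sum.inr ()) ^ 2 := by
  have h : z = Sum.elim (z ∘ Sum.inl) (z ∘ Sum.inr) := (Sum.elim_comp_inl_inr z).symm
  set x := z ∘ Sum.inl
  have e1 : x ⬝ᵥ replicateCol Unit p *ᵥ (z ∘ Sum.inr) = z (Sum.inr ()) * (p ⬝ᵥ x) := by
    simp only [dotProduct, mulVec, replicateCol_apply, Finset.univ_unique, Finset.sum_singleton,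
      Function.comp_apply, Finset.mul_sum, PUnit.default_eq_unit]
    exact Finset.sum_congr rfl fun i _ => by ring
  have e2 : (z ∘ Sum.inr) ⬝ᵥ replicateRow Unit p *ᵥ x = z (Sum.inr ()) * (p ⬝ᵥ x) := by
    simp [dotProduct, mulVec]
  have e3 : (z ∘ Sum.inr) ⬝ᵥ (Matrix.of fun _ _ : Unit => s) *ᵥ (z ∘ Sum.inr) =
      s * z (Sum.inr ()) ^ 2 := by
    simp only [dotProduct, mulVec, of_apply, Finset.univ_unique, Finset.sum_singleton,
      Function.comp_apply, PUnit.default_eq_unit]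
    ring
  conv_lhs => rw [h]
  rw [blockMat, fromBlocks_mulVec]
  simp only [Sum.elim_comp_inl, Sum.elim_comp_inr, sumElim_dotProduct_sumElim, dotProduct_add,
    e1, e2, e3]
  ring

/-- A symmetric matrix in block form. -/
theorem eq_blockMat {n : ℕ} {Y : Matrix (Fin n ⊕ Unit) (Fin n ⊕ Unit) ℝ} (hY : Y.IsSymm) :
    Y = blockMat Y.toBlocks₁₁ (fun j => Y (Sum.inl j) (Sum.inr ())) (Y (Sum.inr ()) (Sum.inr ())) := by
  ext (i | i) (j | j)
  · rfl
  · rfl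
  · exact hY.apply _ _
  · rfl

theorem isSymm_of_mem_completelyPositiveCone {ι : Type*} {Y : Matrix ι ι ℝ}
    (hY : Y ∈ completelyPositiveCone ι) : Y.IsSymm := by
  obtain ⟨K, z, -, rfl⟩ := hY
  simp [IsSymm, transpose_sum, transpose_vecMulVec]

theorem matInner_comm {ι : Type*} [Fintype ι] (M Y : Matrix ι ι ℝ) :
    matInner M Y = matInner Y M := by
  rw [matInner, ← trace_transpose, transpose_mul, transpose_transpose, matInner]

theorem matInner_smul_right {ι : Type*} [Fintype ι] (M Y : Matrix ι ι ℝ) (a : ℝ) :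
    matInner M (a • Y) = a * matInner M Y :=
  map_smul (matInnerCLM M) a Y

theorem dotProduct_corner_mulVec {n : ℕ} (z : Fin n ⊕ Unit → ℝ) :
    z ⬝ᵥ blockMat 0 0 1 *ᵥ z = z (Sum.inr ()) ^ 2 := by
  simp [dotProduct_blockMat_mulVec]

theorem matInner_corner {n : ℕ} {Y : Matrix (Fin n ⊕ Unit) (Fin n ⊕ Unit) ℝ}
    (hY : Y ∈ completelyPositiveCone (Fin n ⊕ Unit)) :
    matInner (blockMat 0 0 1) Y = Y (Sum.inr ()) (Sum.inr ()) := by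
  obtain ⟨K, z, -, rfl⟩ := hY
  rw [matInner_sum_vecMulVec]
  simp only [dotProduct_corner_mulVec, Matrix.sum_apply, vecMulVec_apply, sq]

/-! ### The homogenized constraints and the cone they cut out. -/

namespace MBQP

variable {m n : ℕ} (P : MBQP m n)

theorem dotProduct_linMat_mulVec (i : Fin m) (z : Fin n ⊕ Unit → ℝ) :
    z ⬝ᵥ P.linMat i *ᵥ z = (P.A i ⬝ᵥ (z ∘ Sum.inl) - P.b i * z (Sum.inr ())) ^ 2 := by
  rw [linMat, dotProduct_blockMat_mulVec, vecMulVec_mulVec, smul_dotProduct]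
  simp only [op_smul_eq_smul, dotProduct_smul, smul_eq_mul]
  rw [dotProduct_comm (z ∘ Sum.inl) (P.A i)]
  ring

theorem dotProduct_binMat_mulVec (j : Fin n) (z : Fin n ⊕ Unit → ℝ) :
    z ⬝ᵥ binMat j *ᵥ z = z (Sum.inr ()) * z (Sum.inl j) - z (Sum.inl j) ^ 2 := by
  rw [binMat, dotProduct_blockMat_mulVec, neg_mulVec, vecMulVec_mulVec, smul_dotProduct]
  simp only [op_smul_eq_smul, dotProduct_neg, dotProduct_smul, smul_eq_mul,
    single_one_dotProduct, dotProduct_single_one, Function.comp_apply]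
  ring

/-- The cone of completely positive matrices satisfying the homogeneous constraints. -/
def constraintCone : Set (Matrix (Fin n ⊕ Unit) (Fin n ⊕ Unit) ℝ) :=
  {Y | Y ∈ completelyPositiveCone (Fin n ⊕ Unit) ∧ (∀ i, matInner (P.linMat i) Y = 0) ∧
    ∀ j ∈ P.B, matInner (binMat j) Y = 0}

theorem smul_mem_constraintCone {Y : Matrix (Fin n ⊕ Unit) (Fin n ⊕ Unit) ℝ}
    (hY : Y ∈ P.constraintCone) {a : ℝ} (ha : 0 ≤ a) : a • Y ∈ P.constraintCone := by
  refine ⟨smul_mem_completelyPositiveCone hY.1 ha, fun i => ?_, fun j hj => ?_⟩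
  · rw [matInner_smul_right, hY.2.1 i, mul_zero]
  · rw [matInner_smul_right, hY.2.2 j hj, mul_zero]

theorem blockMat_mem_constraintCone_iff (p : (Fin n → ℝ) × Matrix (Fin n) (Fin n) ℝ) :
    blockMat p.2 p.1 1 ∈ P.constraintCone ↔ p ∈ P.homCPPFeasible :=
  ⟨fun h => ⟨h.2.1, h.2.2, h.1⟩, fun h => ⟨h.2.2, h.1, h.2.1⟩⟩

/-- A feasible point of the quadratic program yields a rank-one matrix in the constraint cone. -/
theorem vecMulVec_mem_constraintCone {x : Fin n → ℝ} (hx : x ∈ P.feasibleRegion) :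
    vecMulVec (Sum.elim x fun _ => 1) (Sum.elim x fun _ => 1) ∈ P.constraintCone := by
  obtain ⟨hA, h0, hB⟩ := hx
  refine ⟨vecMulVec_mem_completelyPositiveCone ?_, fun i => ?_, fun j hj => ?_⟩
  · rintro (j | j)
    · exact h0 j
    · exact zero_le_one
  · have := congrFun hA i
    rw [mulVec] at this
    rw [matInner_vecMulVec, dotProduct_linMat_mulVec, Sum.elim_comp_inl, this]
    simp
  · rw [matInner_vecMulVec, dotProduct_binMat_mulVec]
    rcases hB j hj with h | h <;> simp [h]

/-- A bounded nonempty feasible region has no nonzero recession direction with vanishing binary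
coordinates. -/
theorem eq_zero_of_recession (hne : P.feasibleRegion.Nonempty)
    (hbdd : Bornology.IsBounded P.feasibleRegion) {d : Fin n → ℝ} (hA : P.A *ᵥ d = 0)
    (h0 : ∀ j, 0 ≤ d j) (hB : ∀ j ∈ P.B, d j = 0) : d = 0 := by
  obtain ⟨x, hx⟩ := hne
  obtain ⟨C, hC⟩ := hbdd.exists_norm_le
  ext j
  by_contra hj
  have hpos : 0 < d j := lt_of_le_of_ne (h0 j) (Ne.symm hj)
  have hC0 : 0 ≤ C := (norm_nonneg x).trans (hC x hx)
  -- This step length pushes coordinate `j` to at least `C + 1`, beyond the norm bound `C`.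
  have hs : 0 ≤ (C + 1) / d j := by positivity
  have hmem : x + ((C + 1) / d j) • d ∈ P.feasibleRegion := by
    refine ⟨by rw [mulVec_add, mulVec_smul, hA, smul_zero, add_zero, hx.1],
      fun k => add_nonneg (hx.2.1 k) (mul_nonneg hs (h0 k)), fun k hk => ?_⟩
    simpa [hB k hk] using hx.2.2 k hk
  have h := (norm_le_pi_norm _ j).trans (hC _ hmem)
  rw [Real.norm_eq_abs] at h
  have h' := (le_abs_self _).trans h
  simp only [Pi.add_apply, Pi.smul_apply, smul_eq_mul, div_mul_cancel₀ _ hpos.ne'] at h'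
  linarith [hx.2.1 j]

/-- The only use of boundedness: it excludes nonzero matrices at infinity, where the corner
vanishes. -/
theorem matInner_corner_pos (hne : P.feasibleRegion.Nonempty)
    (hbdd : Bornology.IsBounded P.feasibleRegion) {Y : Matrix (Fin n ⊕ Unit) (Fin n ⊕ Unit) ℝ}
    (hY : Y ∈ P.constraintCone) (hY0 : Y ≠ 0) : 0 < matInner (blockMat 0 0 1) Y := by
  obtain ⟨⟨K, z, hz, rfl⟩, hL, hN⟩ := hY
  simp only [matInner_sum_vecMulVec, dotProduct_corner_mulVec, dotProduct_linMat_mulVec,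
    dotProduct_binMat_mulVec] at hL hN ⊢
  refine lt_of_le_of_ne (Finset.sum_nonneg fun k _ => sq_nonneg _) fun h => hY0 ?_
  have ht : ∀ k, z k (Sum.inr ()) = 0 := fun k => by
    simpa using (Finset.sum_eq_zero_iff_of_nonneg fun k _ => sq_nonneg _).1 h.symm k
      (Finset.mem_univ k)
  refine Finset.sum_eq_zero fun k _ => ?_
  have hx : z k ∘ Sum.inl = 0 := by
    refine P.eq_zero_of_recession hne hbdd (funext fun i => ?_) (fun j => hz k _) fun j hj => ?_
    · have := (Finset.sum_eq_zero_iff_of_nonneg fun k _ => sq_nonneg _).1 (hL i) k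
        (Finset.mem_univ k)
      simpa [ht k, mulVec] using this
    -- The binary form is indefinite in general, but at `t = 0` it is minus a square, so each
    -- summand vanishes.
    · have hN' := hN j hj
      simp only [ht, zero_mul, zero_sub, Finset.sum_neg_distrib, neg_eq_zero] at hN'
      simpa using (Finset.sum_eq_zero_iff_of_nonneg fun k _ => sq_nonneg _).1 hN' k
        (Finset.mem_univ k)
  have : z k = 0 := by
    ext (j | j)
    · exact congrFun hx j
    · exact ht k
  rw [this, vecMulVec_zero]

theorem matInner_dualMat (μ : Fin m → ℝ) (lam : P.B → ℝ) (γ : ℝ)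
    (Y : Matrix (Fin n ⊕ Unit) (Fin n ⊕ Unit) ℝ) :
    matInner (P.dualMat μ lam γ) Y = matInner P.objMat Y - ∑ i, μ i * matInner (P.linMat i) Y -
      ∑ j : P.B, lam j * matInner (binMat (j : Fin n)) Y - γ * matInner (blockMat 0 0 1) Y := by
  simp only [matInner_comm _ Y, ← matInnerCLM_apply, dualMat, map_sub, map_sum, map_smul,
    smul_eq_mul]

/-- Every matrix of the constraint cone with nonzero corner is a positive multiple of a feasible
matrix of the homogenized completely positive program. -/
theorem exists_homCPPFeasible {Y : Matrix (Fin n ⊕ Unit) (Fin n ⊕ Unit) ℝ}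
    (hY : Y ∈ P.constraintCone) (ht : 0 < matInner (blockMat 0 0 1) Y) :
    ∃ p ∈ P.homCPPFeasible, P.homCPPObjective p =
      matInner P.objMat Y / matInner (blockMat 0 0 1) Y := by
  set t := matInner (blockMat 0 0 1) Y with htdef
  have hZ := P.smul_mem_constraintCone hY (inv_nonneg.2 ht.le)
  have hcorner : (t⁻¹ • Y) (Sum.inr ()) (Sum.inr ()) = 1 := by
    rw [← matInner_corner hZ.1, matInner_smul_right, ← htdef, inv_mul_cancel₀ ht.ne']
  have hblock := eq_blockMat (isSymm_of_mem_completelyPositiveCone hZ.1)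
  rw [hcorner] at hblock
  set X := (t⁻¹ • Y).toBlocks₁₁
  set x : Fin n → ℝ := fun j => (t⁻¹ • Y) (Sum.inl j) (Sum.inr ())
  refine ⟨(x, X), (P.blockMat_mem_constraintCone_iff (x, X)).1 (hblock.symm ▸ hZ), ?_⟩
  change matInner P.objMat (blockMat X x 1) = _
  rw [← hblock, matInner_smul_right, div_eq_inv_mul]

theorem matInner_corner_of_feasible {p : (Fin n → ℝ) × Matrix (Fin n) (Fin n) ℝ}
    (hp : p ∈ P.homCPPFeasible) : matInner (blockMat 0 0 1) (blockMat p.2 p.1 1) = 1 := by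
  rw [matInner_corner hp.2.2]
  rfl

/-! ### Weak duality, primal attainment and strong duality. -/

/-- Weak duality. -/
theorem homCOPObjective_le_homCPPObjective {p : (Fin n → ℝ) × Matrix (Fin n) (Fin n) ℝ}
    (hp : p ∈ P.homCPPFeasible) {d : (Fin m → ℝ) × (P.B → ℝ) × ℝ} (hd : d ∈ P.homCOPFeasible) :
    P.homCOPObjective d ≤ P.homCPPObjective p := by
  have h := matInner_nonneg hd hp.2.2
  rw [matInner_dualMat, P.matInner_corner_of_feasible hp,
    Finset.sum_eq_zero fun i _ => by rw [hp.1 i, mul_zero],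
    Finset.sum_eq_zero fun j _ => by rw [hp.2.1 j j.2, mul_zero]] at h
  rw [homCOPObjective, homCPPObjective]
  linarith

theorem homCPPFeasible_nonempty (hne : P.feasibleRegion.Nonempty) : P.homCPPFeasible.Nonempty := by
  obtain ⟨x, hx⟩ := hne
  have hY := P.vecMulVec_mem_constraintCone hx
  obtain ⟨p, hp, -⟩ := P.exists_homCPPFeasible hY (by
    rw [matInner_vecMulVec, dotProduct_corner_mulVec]
    simp)
  exact ⟨p, hp⟩

/-- Normalizing a feasible matrix of the completely positive program to unit trace. -/
theorem inv_trace_smul_mem {p : (Fin n → ℝ) × Matrix (Fin n) (Fin n) ℝ}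
    (hp : p ∈ P.homCPPFeasible) :
    (blockMat p.2 p.1 1).trace⁻¹ • blockMat p.2 p.1 1 ∈
      completelyPositiveBase (Fin n ⊕ Unit) ∩ P.constraintCone ∧
    0 < (blockMat p.2 p.1 1).trace := by
  have hY := (P.blockMat_mem_constraintCone_iff p).2 hp
  have hpos := trace_pos_of_mem_completelyPositiveCone hY.1 (by
    intro h
    have := P.matInner_corner_of_feasible hp
    rw [h, ← matInnerCLM_apply, map_zero] at this
    exact zero_ne_one this)
  have hZ := P.smul_mem_constraintCone hY (inv_nonneg.2 hpos.le)
  refine ⟨⟨mem_completelyPositiveBase_iff.2 ⟨hZ.1, ?_⟩, hZ⟩, hpos⟩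
  rw [trace_smul, smul_eq_mul, inv_mul_cancel₀ hpos.ne']

/-- The minimum of the homogenized completely positive program is attained. -/
theorem exists_isLeast_homCPP (hne : P.feasibleRegion.Nonempty)
    (hbdd : Bornology.IsBounded P.feasibleRegion) :
    ∃ v, IsLeast (P.homCPPObjective '' P.homCPPFeasible) v := by
  set F := completelyPositiveBase (Fin n ⊕ Unit) ∩ P.constraintCone
  -- On the base, cone membership is automatic, so only closed hyperplane conditions remain.
  have hF : F = completelyPositiveBase (Fin n ⊕ Unit) ∩
      ((⋂ i, matInnerCLM (P.linMat i) ⁻¹' {0}) ∩ ⋂ j ∈ P.B, matInnerCLM (binMat j) ⁻¹' {0}) := by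
    ext Y
    simp only [F, constraintCone, mem_inter_iff, mem_iInter, mem_preimage, matInnerCLM_apply,
      mem_singleton_iff, mem_ofPred_eq]
    exact ⟨fun h => ⟨h.1, h.2.2⟩, fun h => ⟨h.1, (completelyPositiveBase_subset h.1).1, h.2⟩⟩
  have hcomp : IsCompact F := by
    rw [hF]
    refine isCompact_completelyPositiveBase.inter_right (IsClosed.inter ?_ ?_)
    · exact isClosed_iInter fun i => isClosed_singleton.preimage (matInnerCLM _).continuous
    · exact isClosed_biInter fun j _ => isClosed_singleton.preimage (matInnerCLM _).continuous
  have hpos : ∀ Y ∈ F, 0 < matInner (blockMat 0 0 1) Y := fun Y hY =>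
    P.matInner_corner_pos hne hbdd hY.2 fun h => by
      have := (completelyPositiveBase_subset hY.1).2
      rw [h, trace_zero] at this
      exact zero_ne_one this
  obtain ⟨p₀, hp₀⟩ := P.homCPPFeasible_nonempty hne
  obtain ⟨Y, hY, hmin⟩ := hcomp.exists_isMinOn ⟨_, (P.inv_trace_smul_mem hp₀).1⟩
    (f := fun Y => matInner P.objMat Y / matInner (blockMat 0 0 1) Y)
    (ContinuousOn.div (matInnerCLM _).continuous.continuousOn
      (matInnerCLM _).continuous.continuousOn fun Y hY => (hpos Y hY).ne')
  obtain ⟨p, hp, hpY⟩ := P.exists_homCPPFeasible hY.2 (hpos Y hY)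
  refine ⟨_, ⟨p, hp, hpY⟩, ?_⟩
  rintro _ ⟨q, hq, rfl⟩
  obtain ⟨hqF, hqpos⟩ := P.inv_trace_smul_mem hq
  have h := hmin hqF
  simp only [mem_ofPred_eq, matInner_smul_right] at h
  rwa [mul_div_mul_left _ _ (inv_ne_zero hqpos.ne'), P.matInner_corner_of_feasible hq,
    div_one] at h

/-- Every value below the optimum of the completely positive program is attained by the dual. -/
theorem exists_homCOPFeasible_of_lt (hne : P.feasibleRegion.Nonempty)
    (hbdd : Bornology.IsBounded P.feasibleRegion) {v γ : ℝ}
    (hv : v ∈ lowerBounds (P.homCPPObjective '' P.homCPPFeasible)) (hγ : γ < v) :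
    ∃ d ∈ P.homCOPFeasible, P.homCOPObjective d = γ := by
  let L : Fin m ⊕ P.B → Matrix (Fin n ⊕ Unit) (Fin n ⊕ Unit) ℝ →L[ℝ] ℝ :=
    Sum.elim (fun i => matInnerCLM (P.linMat i)) fun j => matInnerCLM (binMat (j : Fin n))
  obtain ⟨p₀, hp₀⟩ := P.homCPPFeasible_nonempty hne
  have hp₀F := (P.inv_trace_smul_mem hp₀).1
  let q : Matrix (Fin n ⊕ Unit) (Fin n ⊕ Unit) ℝ →L[ℝ] ℝ :=
    matInnerCLM P.objMat - γ • matInnerCLM (blockMat 0 0 1)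
  have hL₀ : ∀ k, L k _ = 0 := fun k =>
    match k with
    | Sum.inl i => hp₀F.2.2.1 i
    | Sum.inr j => hp₀F.2.2.2 j j.2
  have hpos : ∀ Y ∈ completelyPositiveBase (Fin n ⊕ Unit), (∀ k, L k Y = 0) → 0 < q Y := by
    intro Y hY hLY
    have hY' := completelyPositiveBase_subset hY
    have hYC : Y ∈ P.constraintCone :=
      ⟨hY'.1, fun i => hLY (Sum.inl i), fun j hj => hLY (Sum.inr ⟨j, hj⟩)⟩
    have ht := P.matInner_corner_pos hne hbdd hYC fun h => by
      have hY1 := hY'.2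
      rw [h, trace_zero] at hY1
      exact zero_ne_one hY1
    obtain ⟨p, hp, hpY⟩ := P.exists_homCPPFeasible hYC ht
    have h := hγ.trans_le (hv ⟨p, hp, hpY⟩)
    rw [lt_div_iff₀ ht] at h
    simpa [q] using h
  obtain ⟨c, hc⟩ := exists_multipliers_of_pos (convex_convexHull ℝ _)
    isCompact_completelyPositiveBase L q ⟨_, hp₀F.1, hL₀⟩ hpos
  -- The signs flip because `dualMat` subtracts the constraint matrices.
  refine ⟨(fun i => -c (Sum.inl i), fun j => -c (Sum.inr j), γ),
    mem_copositiveCone_of_matInner_nonneg fun Y hY => ?_, rfl⟩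
  have h := hc Y hY
  rw [Fintype.sum_sum_type] at h
  simp only [L, q, Sum.elim_inl, Sum.elim_inr, _root_.sub_apply,
    _root_.smul_apply, matInnerCLM_apply, smul_eq_mul] at h
  rw [matInner_dualMat]
  simp only [neg_mul, Finset.sum_neg_distrib]
  linarith

end MBQP

/-- Strong duality of the homogenized programs: the minimum of the completely positive program is
attained, and it equals the supremum of its dual copositive program. -/
theorem mainTheorem2 {m n : ℕ} (P : MBQP m n) (hne : P.feasibleRegion.Nonempty)
    (hbdd : Bornology.IsBounded P.feasibleRegion) :
    ∃ v : ℝ, IsLeast (P.homCPPObjective '' P.homCPPFeasible) v ∧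
      IsLUB (P.homCOPObjective '' P.homCOPFeasible) v := by
  obtain ⟨v, hv⟩ := P.exists_isLeast_homCPP hne hbdd
  -- Dual points are available for each value strictly below `v`; this gives the supremum without
  -- dual attainment.
  refine ⟨v, hv, ?_, fun w hw => le_of_forall_lt fun γ hγ => ?_⟩
  · rintro _ ⟨d, hd, rfl⟩
    obtain ⟨p, hp, rfl⟩ := hv.1
    exact P.homCOPObjective_le_homCPPObjective hp hd
  · obtain ⟨γ', hγγ', hγ'⟩ := exists_between hγ
    obtain ⟨d, hd, rfl⟩ := P.exists_homCOPFeasible_of_lt hne hbdd hv.2 hγ'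
    exact hγγ'.trans_le (hw ⟨d, hd, rfl⟩)
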